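/- **Theorem.** Consider either of the two classes of triangulations: type II (no loops, multiple edges allowed) or type III (simple underlying graph). A root of a triangulation $T$ is a triangle of $T$ together with an ordering $(x,y,z)$ of its vertices; $x$ is the root vertex. Let $\mathcal T$ be the space of rooted, connected, locally finite triangulations without boundary, of the given type, of the sphere or of a non-compact planar surface, up to root-preserving equivalence (homeomorphisms, possibly orientation-reversing, respecting vertices, edges and triangles). Equip $\mathcal T$ with the local topology: $T_n\to T$ if for every $r$ the combinatorial balls $B_r(T_n)$ and $B_r(T)$ are equivalent as rooted triangulations for all large $n$. Here $B_0$ is the root vertex, and $B_{r+1}$ consists of all triangles incident to a vertex of $B_r$, with their vertices and edges. For $N\ge 3$ let $\tau_N$ be the uniform distribution on the rooted triangulations in $\mathcal T$ of the sphere with $N$ vertices. A subsequential limit of $(\tau_N)$ is a Borel probability measure $\tau$ on $\mathcal T$ for which there are $n_1<n_2<\cdots$ with $\int f\,d\tau_{n_k}\to\int f\,d\tau$ for every bounded continuous $f:\mathcal T\to\mathbb R$. Let $T$ be chosen according to $\tau_N$ for some $N\ge3$, or according to a subsequential limit $\tau$ of $(\tau_N)$. Given $T$ with root vertex $x$, choose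 an edge at $x$ uniformly at random (so that neighbors are counted with the multiplicity of edges) and let $y$ be its other endpoint; given this, choose $(y,z,w)$ uniformly among all triangles of $T$ containing $y$, with their vertices ordered so that $y$ comes first. Let $T_{(y,z,w)}$ be $T$ with its root replaced by $(y,z,w)$. Then $T_{(y,z,w)}$ has the same law as $T$. -/

import Mathlib

open MeasureTheory Filter Topology BoundedContinuousFunction

/-- The two classes of triangulations: in type II loops are forbidden but multiple edges are
allowed; in type III the underlying graph is simple. -/
inductive TriangulationType
  | typeII
  | typeIII

/-- The flag system of a cellular decomposition of a surface.  A flag is a mutually incident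
triple (vertex, edge, face), that is, a triangle of the barycentric subdivision.
The involution `s i` sends a flag to the flag that differs from it exactly in its cell of
dimension `i`: `s 0` changes the vertex, `s 1` the edge and `s 2` the face. -/
structure FlagSystem where
  Flag : Type
  s : Fin 3 → Flag → Flag
  invol : ∀ i f, s i (s i f) = f
  comm : ∀ f, s 0 (s 2 f) = s 2 (s 0 f)

namespace FlagSystem

variable (M : FlagSystem)

/-- Vertices: classes of flags under changing the edge and the face. -/
def Vertex : Type := Quot fun f g : M.Flag => g = M.s 1 f ∨ g = M.s 2 f

/-- Edges: classes of flags under changing the vertex and the face. -/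
def Edge : Type := Quot fun f g : M.Flag => g = M.s 0 f ∨ g = M.s 2 f

/-- Directed edges: classes of flags under changing the face only. -/
def DirEdge : Type := Quot fun f g : M.Flag => g = M.s 2 f

/-- Connected components: classes of flags under all three involutions. -/
def Component : Type := Quot fun f g : M.Flag => ∃ i, g = M.s i f

/-- The vertex of a flag. -/
def vertex (f : M.Flag) : M.Vertex := Quot.mk _ f

/-- The edge of a flag. -/
def edge (f : M.Flag) : M.Edge := Quot.mk _ f

/-- The edge of a flag, directed away from the vertex of the flag. -/
def dirEdge (f : M.Flag) : M.DirEdge := Quot.mk _ f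

theorem vertex_s_two (f : M.Flag) : M.vertex (M.s 2 f) = M.vertex f :=
  (Quot.sound (r := fun f g : M.Flag => g = M.s 1 f ∨ g = M.s 2 f) (Or.inr rfl)).symm

/-- The initial vertex of a directed edge. -/
def tail : M.DirEdge → M.Vertex :=
  Quot.lift M.vertex (by rintro f g rfl; exact (M.vertex_s_two f).symm)

/-- The terminal vertex of a directed edge. -/
def head : M.DirEdge → M.Vertex :=
  Quot.lift (fun f => M.vertex (M.s 0 f))
    (by rintro f g rfl; simp only [M.comm, M.vertex_s_two])

end FlagSystem

/-- A rooted, connected, locally finite, planar triangulation without boundary, of the given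
type, i.e. a triangulation of the sphere (if there are finitely many flags) or of a connected
non-compact planar surface (if there are infinitely many).

Since there are no loops, each triangle has three distinct vertices, and a flag
(vertex `x`, edge `xy`, triangle `xyz`) is the same thing as a triangle
together with an ordering `(x, y, z)` of its vertices; so a root is a flag.  -/
structure RootedTriangulation (κ : TriangulationType) extends FlagSystem where
  /-- Every cell changes; for `i = 2` this says that there is a triangle on each side of
  each edge, so that the surface has no boundary. -/
  fixedPointFree : ∀ i f, s i f ≠ f
  /-- All faces are triangles. -/
  triangular : ∀ f, s 0 (s 1 (s 0 (s 1 (s 0 (s 1 f))))) = f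
  connected : Subsingleton toFlagSystem.Component
  /-- Each vertex lies in finitely many triangles. -/
  locallyFinite : ∀ v : toFlagSystem.Vertex, {f | toFlagSystem.vertex f = v}.Finite
  noLoops : ∀ f, toFlagSystem.vertex (s 0 f) ≠ toFlagSystem.vertex f
  /-- In type III there are no multiple edges. -/
  simple : κ = TriangulationType.typeIII → ∀ f g,
    toFlagSystem.vertex f = toFlagSystem.vertex g →
    toFlagSystem.vertex (s 0 f) = toFlagSystem.vertex (s 0 g) →
    toFlagSystem.edge f = toFlagSystem.edge g
  /-- Planarity (every closed curve separates): a finite set of edges, with indicator `c`,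
  which contains an even number of the three edges of each triangle (a finite union of closed
  curves transversal to the edges) is the set of edges joining some set of vertices, with
  indicator `u`, to its complement.  For a connected surface without boundary this is
  equivalent to embeddability in the sphere; among closed surfaces only the sphere has it. -/
  planar : ∀ c : toFlagSystem.Edge → ZMod 2, (Function.support c).Finite →
    (∀ f, c (toFlagSystem.edge f) + c (toFlagSystem.edge (s 1 f))
      + c (toFlagSystem.edge (s 1 (s 0 f))) = 0) →
    ∃ u : toFlagSystem.Vertex → ZMod 2, ∀ f,
      c (toFlagSystem.edge f) = u (toFlagSystem.vertex f) + u (toFlagSystem.vertex (s 0 f))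
  root : Flag

namespace RootedTriangulation

variable {κ : TriangulationType}

/-- The same triangulation with the flag `g` marked as the root instead. -/
def reroot (T : RootedTriangulation κ) (g : T.Flag) : RootedTriangulation κ :=
  { T with root := g }

/-- Equivalence of rooted triangulations: a bijection of the flags respecting all
incidences and the root (orientation may be reversed). -/
def Equivalent (T T' : RootedTriangulation κ) : Prop :=
  ∃ φ : T.Flag ≃ T'.Flag, (∀ i f, φ (T.s i f) = T'.s i (φ f)) ∧ φ T.root = T'.root

instance setoid (κ : TriangulationType) : Setoid (RootedTriangulation κ) where
  r := Equivalent
  iseqv :=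
    { refl := fun T => ⟨Equiv.refl _, fun _ _ => rfl, rfl⟩
      symm := by
        rintro T T' ⟨φ, h, hr⟩
        refine ⟨φ.symm, fun i f => ?_, ?_⟩
        · rw [Equiv.symm_apply_eq, h, Equiv.apply_symm_apply]
        · rw [Equiv.symm_apply_eq, hr]
      trans := by
        rintro T T' T'' ⟨φ, h, hr⟩ ⟨ψ, k, kr⟩
        exact ⟨φ.trans ψ, fun i f => by simp [h, k], by simp [hr, kr]⟩ }

/-- The flags of the triangles incident to at least one vertex in `V`. -/
def flagsTouching (T : RootedTriangulation κ) (V : Set T.Vertex) : Set T.Flag :=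
  {f | T.vertex f ∈ V ∨ T.vertex (T.s 0 f) ∈ V ∨ T.vertex (T.s 0 (T.s 1 f)) ∈ V}

/-- The vertices of the combinatorial ball `B_r` around the root vertex: `B_0` is the root
vertex, and `B_{r+1}` consists of the triangles incident to a vertex of `B_r`, with their
vertices and edges. -/
def ballVertices (T : RootedTriangulation κ) : ℕ → Set T.Vertex
  | 0 => {T.vertex T.root}
  | r + 1 => T.vertex '' T.flagsTouching (T.ballVertices r)

/-- The flags of the triangles of the ball `B_r`. -/
def ballFlags (T : RootedTriangulation κ) : ℕ → Set T.Flag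
  | 0 => ∅
  | r + 1 => T.flagsTouching (T.ballVertices r)

/-- The balls `B_r` of `T` and `T'` are equivalent as rooted triangulations: there is a
bijection between their triangles with ordered vertices which respects all incidences between
vertices, edges and triangles of the balls, and the root. -/
def BallEquivalent (r : ℕ) (T T' : RootedTriangulation κ) : Prop :=
  ∃ φ : T.ballFlags r ≃ T'.ballFlags r,
    (∀ i, ∀ f g : T.ballFlags r,
      (g : T.Flag) = T.s i f ↔ (φ g : T'.Flag) = T'.s i (φ f)) ∧
    (∀ f g : T.ballFlags r,
      T.vertex f = T.vertex g ↔ T'.vertex (φ f) = T'.vertex (φ g)) ∧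
    (∀ f : T.ballFlags r, (f : T.Flag) = T.root ↔ (φ f : T'.Flag) = T'.root)

/-- The directed edges starting at the root vertex, one for each edge at the root vertex. -/
def rootDirEdges (T : RootedTriangulation κ) : Set T.DirEdge :=
  {d | T.tail d = T.vertex T.root}

/-- The possible roots `(y, z, w)` with root vertex `y`. -/
def rootsAt (T : RootedTriangulation κ) (y : T.Vertex) : Set T.Flag :=
  {f | T.vertex f = y}

theorem rootDirEdges_finite (T : RootedTriangulation κ) : T.rootDirEdges.Finite := by
  refine ((T.locallyFinite (T.vertex T.root)).image T.dirEdge).subset ?_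
  rintro ⟨f⟩ hf
  exact ⟨f, hf, rfl⟩

theorem rootDirEdges_nonempty (T : RootedTriangulation κ) : T.rootDirEdges.Nonempty :=
  ⟨T.dirEdge T.root, rfl⟩

theorem rootsAt_finite (T : RootedTriangulation κ) (y : T.Vertex) : (T.rootsAt y).Finite :=
  T.locallyFinite y

theorem rootsAt_nonempty (T : RootedTriangulation κ) (y : T.Vertex) : (T.rootsAt y).Nonempty := by
  obtain ⟨f⟩ := y
  exact ⟨f, rfl⟩

end RootedTriangulation

/-- The space of rooted triangulations of type `κ` up to equivalence. -/
def TriangulationSpace (κ : TriangulationType) : Type 1 :=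
  Quotient (RootedTriangulation.setoid κ)

namespace TriangulationSpace

variable {κ : TriangulationType}

/-- The equivalence class of a rooted triangulation. -/
def mk (T : RootedTriangulation κ) : TriangulationSpace κ := Quotient.mk _ T

/-- The local topology, generated by the sets of all triangulations whose ball of radius `r`
around the root vertex is equivalent to that of a given one; these sets are the balls of the
metric given by the reciprocal of the largest radius in which two triangulations agree. -/
instance : TopologicalSpace (TriangulationSpace κ) :=
  TopologicalSpace.generateFrom
    {U | ∃ (r : ℕ) (T : RootedTriangulation κ),
      U = {t | ∃ T' : RootedTriangulation κ,
        t = mk T' ∧ RootedTriangulation.BallEquivalent r T T'}}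

instance : MeasurableSpace (TriangulationSpace κ) := borel _

instance : BorelSpace (TriangulationSpace κ) := ⟨rfl⟩

/-- The rooted triangulations of the sphere with `N` vertices. -/
def sphere (κ : TriangulationType) (N : ℕ) : Set (TriangulationSpace κ) :=
  {t | ∃ T : RootedTriangulation κ,
    t = mk T ∧ Finite T.Flag ∧ Nat.card T.Vertex = N}

/-- The uniform distribution on rooted triangulations of the sphere with `N` vertices. -/
noncomputable def uniformSphere (κ : TriangulationType) (N : ℕ) :
    Measure (TriangulationSpace κ) :=
  ProbabilityTheory.uniformOn (sphere κ N)

end TriangulationSpace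

/-- The uniform distribution on a finite nonempty set. -/
noncomputable def uniformPMF {α : Type*} (A : Set α) (hA : A.Finite) (hne : A.Nonempty) :
    PMF α :=
  PMF.uniformOfFinset hA.toFinset (hA.toFinset_nonempty.2 hne)

theorem uniformPMF_map {α β : Type*} (e : α ≃ β) (A : Set α) (B : Set β)
    (hA : A.Finite) (hne : A.Nonempty) (hB : B.Finite) (hne' : B.Nonempty)
    (h : ∀ a, e a ∈ B ↔ a ∈ A) :
    (uniformPMF A hA hne).map e = uniformPMF B hB hne' := by
  classical
  have hcard : hB.toFinset.card = hA.toFinset.card := by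
    refine (Finset.card_bij (fun a _ => e a) ?_ ?_ ?_).symm
    · intro a ha; simpa [h] using ha
    · intro a _ b _ hab; exact e.injective hab
    · intro b hb
      exact ⟨e.symm b, by simpa [← h] using hb, by simp⟩
  ext b
  rw [PMF.map_apply, tsum_eq_single (e.symm b)]
  · have := h (e.symm b)
    simp only [Equiv.apply_symm_apply] at this
    simp [uniformPMF, PMF.uniformOfFinset_apply, this, hcard]
  · intro a ha
    rw [if_neg]
    rintro rfl
    simp at ha

namespace RootedTriangulation

variable {κ : TriangulationType}

/-- The law of the triangulation re-rooted after one step of the random walk, for a fixed `T`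
with root vertex `x`: choose an edge at `x` uniformly, let `y` be its other endpoint, choose
`(y, z, w)` uniformly among the triangles containing `y`, with their vertices ordered so that `y`
comes first, and make it the root. -/
noncomputable def walkReroot (T : RootedTriangulation κ) : PMF (TriangulationSpace κ) :=
  (uniformPMF T.rootDirEdges T.rootDirEdges_finite T.rootDirEdges_nonempty).bind fun d =>
    (uniformPMF (T.rootsAt (T.head d)) (T.rootsAt_finite _) (T.rootsAt_nonempty _)).map fun g =>
      TriangulationSpace.mk (T.reroot g)

theorem walkReroot_congr (T T' : RootedTriangulation κ) (h : Equivalent T T') :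
    T.walkReroot = T'.walkReroot := by
  obtain ⟨φ, hφ, hr⟩ := h
  have hψ : ∀ i f, φ.symm (T'.s i f) = T.s i (φ.symm f) := fun i f => by
    rw [Equiv.symm_apply_eq, hφ, Equiv.apply_symm_apply]
  have hv : ∀ f g, T.vertex f = T.vertex g → T'.vertex (φ f) = T'.vertex (φ g) := by
    intro f g hfg
    exact congrArg (Quot.map φ (rb := fun f g => g = T'.s 1 f ∨ g = T'.s 2 f)
      (by rintro a b (rfl | rfl) <;> simp [hφ])) hfg
  have hv' : ∀ f g, T'.vertex f = T'.vertex g → T.vertex (φ.symm f) = T.vertex (φ.symm g) := by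
    intro f g hfg
    exact congrArg (Quot.map φ.symm (rb := fun f g => g = T.s 1 f ∨ g = T.s 2 f)
      (by rintro a b (rfl | rfl) <;> simp [hψ])) hfg
  have hvi : ∀ f g, T'.vertex (φ f) = T'.vertex (φ g) ↔ T.vertex f = T.vertex g :=
    fun f g => ⟨fun k => by simpa using hv' _ _ k, hv f g⟩
  let e : T.DirEdge ≃ T'.DirEdge :=
    { toFun := Quot.map φ (by rintro a b rfl; simp [hφ])
      invFun := Quot.map φ.symm (by rintro a b rfl; simp [hψ])
      left_inv := by rintro ⟨f⟩; exact congrArg (Quot.mk _) (φ.symm_apply_apply f)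
      right_inv := by rintro ⟨f⟩; exact congrArg (Quot.mk _) (φ.apply_symm_apply f) }
  have he : ∀ f, e (T.dirEdge f) = T'.dirEdge (φ f) := fun f => rfl
  unfold walkReroot
  rw [← uniformPMF_map e T.rootDirEdges T'.rootDirEdges T.rootDirEdges_finite
    T.rootDirEdges_nonempty, PMF.bind_map]
  · congr 1
    funext d
    obtain ⟨f, rfl⟩ : ∃ f, T.dirEdge f = d := Quot.exists_rep d
    simp only [Function.comp_apply]
    rw [← uniformPMF_map φ (T.rootsAt (T.head (T.dirEdge f)))
      (T'.rootsAt (T'.head (e (T.dirEdge f)))) (T.rootsAt_finite _) (T.rootsAt_nonempty _),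
      PMF.map_comp]
    · congr 1
      funext g
      exact Quotient.sound ⟨φ, hφ, rfl⟩
    · intro g
      rw [he]
      show T'.vertex (φ g) = T'.vertex (T'.s 0 (φ f)) ↔ T.vertex g = T.vertex (T.s 0 f)
      rw [← hφ, hvi]
  · intro d
    obtain ⟨f, rfl⟩ : ∃ f, T.dirEdge f = d := Quot.exists_rep d
    rw [he]
    show T'.vertex (φ f) = T'.vertex T'.root ↔ T.vertex f = T.vertex T.root
    rw [← hr, hvi]

end RootedTriangulation

namespace TriangulationSpace

variable {κ : TriangulationType}

/-- The law of `T_{(y,z,w)}` for fixed `T`, on equivalence classes. -/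
noncomputable def walkReroot : TriangulationSpace κ → PMF (TriangulationSpace κ) :=
  Quotient.lift RootedTriangulation.walkReroot RootedTriangulation.walkReroot_congr

/-- The law of `T_{(y,z,w)}` when `T` has law `μ`. -/
noncomputable def rerootedLaw (μ : Measure (TriangulationSpace κ)) :
    Measure (TriangulationSpace κ) :=
  μ.bind fun t => (walkReroot t).toMeasure

/-- `τ` is a subsequential weak limit of the uniform distributions on rooted triangulations of
the sphere. -/
def IsSubsequentialLimit (τ : Measure (TriangulationSpace κ)) : Prop :=
  IsProbabilityMeasure τ ∧ ∃ n : ℕ → ℕ, StrictMono n ∧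
    ∀ f : TriangulationSpace κ →ᵇ ℝ,
      Tendsto (fun k => ∫ t, f t ∂(uniformSphere κ (n k))) atTop (𝓝 (∫ t, f t ∂τ))

end TriangulationSpace

/-! Random walk on a graph is reversible for the degree measure, and a uniform flag of a finite
triangulation has its vertex distributed proportionally to degree, since a vertex of degree d lies
in 2d flags. At the level of flags, one step replaces the root by a uniform flag at the same vertex
(this selects a uniform edge, each directed edge lying in two flags), applies `s 0` to cross the
edge, and again takes a uniform flag at the vertex reached. Each of the three operations preserves
the uniform law on flags: two average over the classes of a partition, one is a bijection.

Rooted triangulations are flags up to automorphism. By connectedness automorphisms act freely on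
flags, so every rooting of a finite T comes from the same number of flags, and the uniform law on
the rootings of T is stationary (`uniformPMF_range_bind_walkReroot`). The triangulations of the
sphere with N vertices split into such classes; if there are finitely many, stationarity means that
the transition kernel has column sums 1 on them (`sum_walkReroot_of_sphere`).

For limits, the kernel is local: the probability of landing in a cylinder of radius r depends only
on the ball of radius r + 2 (`walkReroot_map_mem_cylinder`). It is therefore a bounded continuous
function of the triangulation, as is the indicator of the clopen cylinder. Their integrals agree
along the sequence, hence in the limit, and cylinders form a π-system generating the Borel sets. -/

/-! ### Uniform distributions under maps and partitions -/

section UniformPMF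

variable {α β γ : Type*}

theorem uniformPMF_apply_of_mem {A : Set α} (hA : A.Finite) (hne : A.Nonempty) {a : α}
    (ha : a ∈ A) : uniformPMF A hA hne a = (A.ncard : ENNReal)⁻¹ := by
  rw [uniformPMF, PMF.uniformOfFinset_apply_of_mem _ (by simpa using ha),
    Set.ncard_eq_toFinset_card A hA]

theorem uniformPMF_apply_of_notMem {A : Set α} (hA : A.Finite) (hne : A.Nonempty) {a : α}
    (ha : a ∉ A) : uniformPMF A hA hne a = 0 :=
  PMF.uniformOfFinset_apply_of_notMem _ (by simpa using ha)

theorem mem_support_uniformPMF {A : Set α} (hA : A.Finite) (hne : A.Nonempty) {a : α} :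
    a ∈ (uniformPMF A hA hne).support ↔ a ∈ A := by
  simp [uniformPMF]

/-- A map from `A` to `B` all of whose fibres have the same size sends the uniform distribution
on `A` to the uniform distribution on `B`. -/
theorem uniformPMF_map_of_fiber {A : Set α} {B : Set β} (f : α → β) (m : ℕ)
    (hA : A.Finite) (hne : A.Nonempty) (hB : B.Finite) (hne' : B.Nonempty)
    (hf : Set.MapsTo f A B) (hm : ∀ b ∈ B, {a | a ∈ A ∧ f a = b}.ncard = m) :
    (uniformPMF A hA hne).map f = uniformPMF B hB hne' := by
  classical
  have hm' : ∀ b ∈ B, (hA.toFinset.filter fun a => f a = b).card = m := by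
    intro b hb
    rw [← hm b hb, ← Set.ncard_coe_finset]
    congr 1
    ext a
    simp
  have hcard : A.ncard = B.ncard * m := by
    rw [Set.ncard_eq_toFinset_card A hA, Set.ncard_eq_toFinset_card B hB,
      Finset.card_eq_sum_card_fiberwise (f := f) (t := hB.toFinset)
        (fun a ha => by simpa using hf (by simpa using ha)),
      Finset.sum_congr rfl fun b hb => hm' b (by simpa using hb)]
    simp
  have hA0 : A.ncard ≠ 0 := ((Set.ncard_pos hA).2 hne).ne'
  have hm0 : m ≠ 0 := by rintro rfl; simp [hcard] at hA0
  ext b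
  rw [PMF.map_apply, tsum_eq_sum (s := hA.toFinset)]
  · have h1 : ∀ a ∈ hA.toFinset, (if b = f a then uniformPMF A hA hne a else 0)
        = if f a = b then (A.ncard : ENNReal)⁻¹ else 0 := by
      intro a ha
      rw [uniformPMF_apply_of_mem hA hne (by simpa using ha)]
      simp only [eq_comm]
    rw [Finset.sum_congr rfl h1, ← Finset.sum_filter, Finset.sum_const, nsmul_eq_mul]
    by_cases hb : b ∈ B
    · rw [hm' b hb, uniformPMF_apply_of_mem hB hne' hb, hcard, Nat.cast_mul,
        ENNReal.mul_inv (by simp) (by simp), mul_left_comm,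
        ENNReal.mul_inv_cancel (by simpa using hm0) (by simp), mul_one]
    · rw [uniformPMF_apply_of_notMem hB hne' hb, Finset.filter_eq_empty_iff.2]
      · simp
      · rintro a ha rfl
        exact hb (hf (by simpa using ha))
  · intro a ha
    rw [uniformPMF_apply_of_notMem hA hne (by simpa using ha)]
    simp

theorem uniformPMF_map_of_bijOn {A : Set α} {B : Set β} {f : α → β}
    (hA : A.Finite) (hne : A.Nonempty) (hB : B.Finite) (hne' : B.Nonempty)
    (hf : Set.BijOn f A B) :
    (uniformPMF A hA hne).map f = uniformPMF B hB hne' := by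
  refine uniformPMF_map_of_fiber f 1 hA hne hB hne' hf.mapsTo fun b hb => ?_
  obtain ⟨a, ha, rfl⟩ := hf.surjOn hb
  rw [Set.ncard_eq_one]
  refine ⟨a, ?_⟩
  ext a'
  exact ⟨fun h => hf.injOn h.1 ha h.2, by rintro rfl; exact ⟨ha, rfl⟩⟩

theorem PMF.bind_congr_of_support (p : PMF α) {f g : α → PMF β}
    (h : ∀ a ∈ p.support, f a = g a) : p.bind f = p.bind g := by
  ext b
  rw [PMF.bind_apply, PMF.bind_apply]
  refine tsum_congr fun a => ?_
  by_cases ha : p a = 0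
  · simp [ha]
  · rw [h a ((p.mem_support_iff a).2 ha)]

theorem uniformPMF_bind_of_bijOn {A : Set α} {B : Set β} {e : α → β}
    (hA : A.Finite) (hne : A.Nonempty) (hB : B.Finite) (hne' : B.Nonempty)
    (he : Set.BijOn e A B) {f : α → PMF γ} {g : β → PMF γ} (h : ∀ a ∈ A, f a = g (e a)) :
    (uniformPMF A hA hne).bind f = (uniformPMF B hB hne').bind g := by
  rw [← uniformPMF_map_of_bijOn hA hne hB hne' he, PMF.bind_map]
  exact PMF.bind_congr_of_support _ fun a ha => h a ((mem_support_uniformPMF hA hne).1 ha)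

/-- Averaging over the classes of a partition preserves the uniform distribution. -/
theorem uniformPMF_univ_bind_fiber [Finite α] (v : α → β)
    (hu : (Set.univ : Set α).Nonempty) (hne : ∀ a, {b | v b = v a}.Nonempty) :
    ((uniformPMF (Set.univ : Set α) Set.finite_univ hu).bind fun a =>
      uniformPMF {b | v b = v a} (Set.toFinite _) (hne a))
      = uniformPMF (Set.univ : Set α) Set.finite_univ hu := by
  classical
  have := Fintype.ofFinite α
  ext b
  rw [PMF.bind_apply, tsum_fintype]
  have h1 : ∀ a, uniformPMF (Set.univ : Set α) Set.finite_univ hu a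
      * uniformPMF {b | v b = v a} (Set.toFinite _) (hne a) b
      = if v a = v b then ((Set.univ : Set α).ncard : ENNReal)⁻¹
          * (({a | v a = v b} : Set α).ncard : ENNReal)⁻¹ else 0 := by
    intro a
    rw [uniformPMF_apply_of_mem _ _ (Set.mem_univ a)]
    split_ifs with h
    · rw [uniformPMF_apply_of_mem (A := {b | v b = v a}) _ _ h.symm, h]
    · rw [uniformPMF_apply_of_notMem (A := {b | v b = v a}) _ _ fun h' => h (Eq.symm h'), mul_zero]
  rw [Finset.sum_congr rfl fun a _ => h1 a, ← Finset.sum_filter, Finset.sum_const, nsmul_eq_mul,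
    uniformPMF_apply_of_mem _ _ (Set.mem_univ b)]
  have h2 : (Finset.univ.filter fun a => v a = v b).card = ({a | v a = v b} : Set α).ncard := by
    rw [← Set.ncard_coe_finset]
    congr 1
    ext a
    simp
  have h3 : ({a | v a = v b} : Set α).ncard ≠ 0 :=
    ((Set.ncard_pos (Set.toFinite _)).2 (hne b)).ne'
  rw [h2, mul_left_comm, ENNReal.mul_inv_cancel (by simpa using h3) (by simp), mul_one]

end UniformPMF

/-! ### Flag systems: directed edges and connectedness -/

namespace FlagSystem

variable (M : FlagSystem)

theorem vertex_s_one (f : M.Flag) : M.vertex (M.s 1 f) = M.vertex f :=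
  (Quot.sound (r := fun f g : M.Flag => g = M.s 1 f ∨ g = M.s 2 f) (Or.inl rfl)).symm

theorem dirEdge_s_two (f : M.Flag) : M.dirEdge (M.s 2 f) = M.dirEdge f :=
  (Quot.sound (r := fun f g : M.Flag => g = M.s 2 f) rfl).symm

theorem dirEdge_eq_iff (f g : M.Flag) : M.dirEdge f = M.dirEdge g ↔ f = g ∨ f = M.s 2 g := by
  constructor
  · intro h
    -- The unordered pair of a flag and its `s 2`-image is invariant under `s 2`, so it descends to
    -- the quotient.
    have h' : ({f, M.s 2 f} : Set M.Flag) = {g, M.s 2 g} := by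
      refine congrArg (Quot.lift (fun f => ({f, M.s 2 f} : Set M.Flag)) ?_) h
      rintro a b rfl
      rw [M.invol, Set.pair_comm]
    have : f ∈ ({g, M.s 2 g} : Set M.Flag) := h' ▸ Set.mem_insert _ _
    simpa using this
  · rintro (rfl | rfl)
    · rfl
    · exact M.dirEdge_s_two g

theorem s_injective (i : Fin 3) : Function.Injective (M.s i) :=
  Function.LeftInverse.injective (M.invol i)

theorem s_bijective (i : Fin 3) : Function.Bijective (M.s i) :=
  Function.Involutive.bijective (M.invol i)

/-- A property of flags which is preserved by the involutions and holds for one flag of a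
connected flag system holds for all flags. -/
theorem connected_induction (hM : Subsingleton M.Component) {P : M.Flag → Prop} {f₀ : M.Flag}
    (h₀ : P f₀) (hs : ∀ i f, P f → P (M.s i f)) (f : M.Flag) : P f := by
  have h : (Quot.mk _ f₀ : M.Component) = Quot.mk _ f := hM.elim _ _
  have h' : P f₀ = P f := by
    refine congrArg (Quot.lift P ?_) h
    rintro a b ⟨i, rfl⟩
    exact propext ⟨hs i a, fun h => by simpa [M.invol] using hs i _ h⟩
  exact h' ▸ h₀

end FlagSystem

/-! ### Stationarity for finite triangulations -/

namespace RootedTriangulation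

variable {κ : TriangulationType} (T : RootedTriangulation κ)

/-- The map sending a flag to the triangulation rooted at it. -/
def rootedAt (g : T.Flag) : TriangulationSpace κ :=
  TriangulationSpace.mk (T.reroot g)

/-- Each directed edge lies in exactly two flags, so a uniform edge at the root vertex may be
sampled as the edge of a uniform flag at the root vertex. -/
theorem walkReroot_eq :
    T.walkReroot = (uniformPMF (T.rootsAt (T.vertex T.root)) (T.rootsAt_finite _)
      (T.rootsAt_nonempty _)).bind fun f =>
        (uniformPMF (T.rootsAt (T.vertex (T.s 0 f))) (T.rootsAt_finite _)
          (T.rootsAt_nonempty _)).map T.rootedAt := by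
  unfold walkReroot
  rw [← uniformPMF_map_of_fiber (A := T.rootsAt (T.vertex T.root)) (B := T.rootDirEdges)
    T.dirEdge 2 (T.rootsAt_finite _) (T.rootsAt_nonempty _) T.rootDirEdges_finite
    T.rootDirEdges_nonempty (fun f hf => hf), PMF.bind_map]
  · rfl
  · rintro ⟨f⟩ hf
    have : {a | a ∈ T.rootsAt (T.vertex T.root) ∧ T.dirEdge a = Quot.mk _ f}
        = {f, T.s 2 f} := by
      ext a
      refine ⟨fun h => (T.dirEdge_eq_iff a f).1 h.2, fun h => ⟨?_, (T.dirEdge_eq_iff a f).2 h⟩⟩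
      rcases h with rfl | rfl
      · exact hf
      · exact (T.vertex_s_two f).trans hf
    rw [this, Set.ncard_pair (T.fixedPointFree 2 f).symm]

theorem exists_rootedAt_of_mem_support {u : TriangulationSpace κ}
    (hu : u ∈ T.walkReroot.support) : ∃ g, u = T.rootedAt g := by
  rw [walkReroot_eq, PMF.mem_support_bind_iff] at hu
  obtain ⟨f, -, hf⟩ := hu
  rw [PMF.mem_support_map_iff] at hf
  obtain ⟨g, -, rfl⟩ := hf
  exact ⟨g, rfl⟩

/-- The automorphisms of a triangulation, ignoring the root. -/
def automorphisms : Set (Equiv.Perm T.Flag) :=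
  {φ | ∀ i f, φ (T.s i f) = T.s i (φ f)}

theorem rootedAt_eq_iff (f g : T.Flag) :
    T.rootedAt f = T.rootedAt g ↔ ∃ φ ∈ T.automorphisms, φ g = f := by
  constructor
  · intro h
    obtain ⟨φ, hφ, hr⟩ := Quotient.exact h.symm
    exact ⟨φ, hφ, hr⟩
  · rintro ⟨φ, hφ, hr⟩
    exact (Quotient.sound ⟨φ, hφ, hr⟩ : T.rootedAt g = T.rootedAt f).symm

/-- An automorphism of a connected triangulation is determined by the image of one flag. -/
theorem automorphisms_injOn (g : T.Flag) :
    Set.InjOn (fun φ : Equiv.Perm T.Flag => φ g) T.automorphisms := by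
  intro φ hφ ψ hψ h
  refine Equiv.ext fun f => ?_
  refine T.connected_induction T.connected (P := fun f => φ f = ψ f) h (fun i f hf => ?_) f
  rw [hφ, hψ, hf]

/-- The fibre is the orbit of `g` under the automorphisms, which act freely; hence its size does not
depend on `g`. -/
theorem ncard_rootedAt_fiber (g : T.Flag) :
    {f | T.rootedAt f = T.rootedAt g}.ncard = T.automorphisms.ncard := by
  rw [← (T.automorphisms_injOn g).ncard_image]
  congr 1
  ext f
  exact T.rootedAt_eq_iff f g

theorem uniformPMF_univ_map_rootedAt [Finite T.Flag] :
    (uniformPMF (Set.univ : Set T.Flag) Set.finite_univ ⟨T.root, Set.mem_univ _⟩).map T.rootedAt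
      = uniformPMF (Set.range T.rootedAt) (Set.finite_range _) ⟨_, Set.mem_range_self T.root⟩ := by
  refine uniformPMF_map_of_fiber _ T.automorphisms.ncard _ _ _ _
    (fun f _ => Set.mem_range_self f) ?_
  rintro _ ⟨g, rfl⟩
  rw [← T.ncard_rootedAt_fiber g]
  congr 1
  ext f
  simp

/-- For a finite triangulation with a uniform root, the re-rooted triangulation has the same
law. -/
theorem uniformPMF_range_bind_walkReroot [Finite T.Flag] :
    (uniformPMF (Set.range T.rootedAt) (Set.finite_range _) ⟨_, Set.mem_range_self T.root⟩).bind
        TriangulationSpace.walkReroot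
      = uniformPMF (Set.range T.rootedAt) (Set.finite_range _) ⟨_, Set.mem_range_self T.root⟩ := by
  have hne : ∀ a, {b | T.vertex b = T.vertex a}.Nonempty := fun a => ⟨a, rfl⟩
  have hav := uniformPMF_univ_bind_fiber T.vertex ⟨T.root, Set.mem_univ _⟩ hne
  have hs : (uniformPMF (Set.univ : Set T.Flag) Set.finite_univ ⟨T.root, Set.mem_univ _⟩).map (T.s 0)
      = uniformPMF (Set.univ : Set T.Flag) Set.finite_univ ⟨T.root, Set.mem_univ _⟩ :=
    uniformPMF_map_of_bijOn _ _ _ _ (Set.bijOn_univ.2 (T.s_bijective 0))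
  have hw : ∀ h, TriangulationSpace.walkReroot (T.rootedAt h)
      = (uniformPMF {b | T.vertex b = T.vertex h} (Set.toFinite _) (hne h)).bind fun f =>
        (uniformPMF {b | T.vertex b = T.vertex (T.s 0 f)} (Set.toFinite _) (hne _)).map
          T.rootedAt :=
    fun h => (T.reroot h).walkReroot_eq
  conv_lhs => rw [← uniformPMF_univ_map_rootedAt, PMF.bind_map]
  -- The uniform law on flags is expanded, from the last operation to the first, as average at a
  -- vertex, `s 0`, average at a vertex, until it reads as the walk.
  conv_rhs => rw [← uniformPMF_univ_map_rootedAt, ← hav, ← hs]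
  rw [PMF.bind_map, PMF.map_bind]
  conv_rhs => rw [← hav, PMF.bind_bind]
  congr 1
  funext h
  exact hw h

end RootedTriangulation

namespace TriangulationSpace

variable {κ : TriangulationType}

/-- Column sums of the transition kernel. Only rootings of the same triangulation can lead to `u`,
and among these the invariance of the uniform law, multiplied by their number, gives 1. -/
theorem sum_walkReroot_of_sphere {N : ℕ} (hS : (sphere κ N).Finite) (u : TriangulationSpace κ) :
    ∑ t ∈ hS.toFinset, walkReroot t u = (sphere κ N).indicator 1 u := by
  classical
  by_cases hu : u ∈ sphere κ N
  · rw [Set.indicator_of_mem hu]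
    obtain ⟨T, rfl, hfin, hcard⟩ := hu
    have hO : (Set.range T.rootedAt).Finite := Set.finite_range _
    have hmem : mk T ∈ Set.range T.rootedAt := ⟨T.root, rfl⟩
    have hsub : hO.toFinset ⊆ hS.toFinset := by
      intro t ht
      obtain ⟨g, rfl⟩ := hO.mem_toFinset.1 ht
      exact hS.mem_toFinset.2 ⟨T.reroot g, rfl, hfin, hcard⟩
    rw [← Finset.sum_subset hsub]
    · have h := DFunLike.congr_fun T.uniformPMF_range_bind_walkReroot (mk T)
      rw [uniformPMF_apply_of_mem hO ⟨_, hmem⟩ hmem, PMF.bind_apply, tsum_eq_sum (s := hO.toFinset)] at h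
      · rw [Finset.sum_congr rfl fun t ht => by
          rw [uniformPMF_apply_of_mem hO ⟨_, hmem⟩ (hO.mem_toFinset.1 ht)], ← Finset.mul_sum] at h
        have h0 : ((Set.range T.rootedAt).ncard : ENNReal) ≠ 0 := by
          exact_mod_cast ((Set.ncard_pos hO).2 ⟨_, hmem⟩).ne'
        have h1 := congrArg (fun x => ((Set.range T.rootedAt).ncard : ENNReal) * x) h
        simpa [← mul_assoc, ENNReal.mul_inv_cancel h0] using h1
      · intro t ht
        rw [uniformPMF_apply_of_notMem hO ⟨_, hmem⟩ (by simpa using ht), zero_mul]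
    · intro t _ ht
      -- If `t` leads to `mk T`, then `T` is a rooting of `T'`; carrying the root of `T'` through
      -- the isomorphism shows that `t` is a rooting of `T`.
      by_contra h0
      obtain ⟨T', rfl⟩ : ∃ T', mk T' = t := Quotient.exists_rep t
      obtain ⟨g, hg⟩ := T'.exists_rootedAt_of_mem_support ((PMF.mem_support_iff _ _).2 h0)
      obtain ⟨φ, hφ, -⟩ := Quotient.exact hg.symm
      exact ht (hO.mem_toFinset.2 ⟨φ T'.root, (Quotient.sound ⟨φ, hφ, rfl⟩ :
        mk T' = mk (T.reroot (φ T'.root))).symm⟩)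
  · rw [Set.indicator_of_notMem hu]
    refine Finset.sum_eq_zero fun t ht => ?_
    by_contra h0
    obtain ⟨T, rfl, hfin, hcard⟩ := hS.mem_toFinset.1 ht
    obtain ⟨g, rfl⟩ := T.exists_rootedAt_of_mem_support ((PMF.mem_support_iff _ _).2 h0)
    exact hu ⟨T.reroot g, rfl, hfin, hcard⟩

end TriangulationSpace

/-! ### Combinatorial balls and their isomorphisms -/

namespace RootedTriangulation

variable {κ : TriangulationType}

section Balls

variable (T : RootedTriangulation κ)

/-- Braid form of the triangle relation. It shows that `f` and `s 0 f` see the same third corner, so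
that balls consist of whole triangles and only `s 2` can leave them. -/
theorem s_zero_one_zero (f : T.Flag) :
    T.s 0 (T.s 1 (T.s 0 f)) = T.s 1 (T.s 0 (T.s 1 f)) := by
  have h' := T.triangular f
  rw [← T.s_injective 0 |>.eq_iff, ← T.s_injective 1 |>.eq_iff, ← T.s_injective 0 |>.eq_iff]
  rw [h', T.invol, T.invol, T.invol]

variable {T}

theorem s_zero_mem_flagsTouching {V : Set T.Vertex} {f : T.Flag} (h : f ∈ T.flagsTouching V) :
    T.s 0 f ∈ T.flagsTouching V := by
  have h3 : T.vertex (T.s 0 (T.s 1 (T.s 0 f))) = T.vertex (T.s 0 (T.s 1 f)) := by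
    rw [s_zero_one_zero, T.vertex_s_one]
  rcases h with h | h | h
  · exact Or.inr (Or.inl (by rwa [T.invol]))
  · exact Or.inl h
  · exact Or.inr (Or.inr (by rwa [h3]))

theorem s_one_mem_flagsTouching {V : Set T.Vertex} {f : T.Flag} (h : f ∈ T.flagsTouching V) :
    T.s 1 f ∈ T.flagsTouching V := by
  rcases h with h | h | h
  · exact Or.inl (by rwa [T.vertex_s_one])
  · exact Or.inr (Or.inr (by rwa [T.invol]))
  · exact Or.inr (Or.inl h)

theorem flagsTouching_mono {V W : Set T.Vertex} (h : V ⊆ W) :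
    T.flagsTouching V ⊆ T.flagsTouching W := by
  rintro f (hf | hf | hf)
  · exact Or.inl (h hf)
  · exact Or.inr (Or.inl (h hf))
  · exact Or.inr (Or.inr (h hf))

theorem s_zero_mem_ballFlags {r : ℕ} {f : T.Flag} (h : f ∈ T.ballFlags r) :
    T.s 0 f ∈ T.ballFlags r := by
  cases r with
  | zero => exact h
  | succ r => exact s_zero_mem_flagsTouching h

theorem s_one_mem_ballFlags {r : ℕ} {f : T.Flag} (h : f ∈ T.ballFlags r) :
    T.s 1 f ∈ T.ballFlags r := by
  cases r with
  | zero => exact h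
  | succ r => exact s_one_mem_flagsTouching h

theorem vertex_mem_ballVertices {r : ℕ} {f : T.Flag} (h : f ∈ T.ballFlags r) :
    T.vertex f ∈ T.ballVertices r := by
  cases r with
  | zero => exact h.elim
  | succ r => exact ⟨f, h, rfl⟩

theorem mem_ballFlags_of_vertex {r : ℕ} {f : T.Flag} (h : T.vertex f ∈ T.ballVertices r) :
    f ∈ T.ballFlags (r + 1) :=
  Or.inl h

theorem ballVertices_mono : Monotone T.ballVertices := by
  refine monotone_nat_of_le_succ fun r v hv => ?_
  obtain ⟨f, rfl⟩ : ∃ f, T.vertex f = v := Quot.exists_rep v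
  exact vertex_mem_ballVertices (mem_ballFlags_of_vertex hv)

theorem ballFlags_mono : Monotone T.ballFlags := by
  refine monotone_nat_of_le_succ fun r f hf => ?_
  exact mem_ballFlags_of_vertex (vertex_mem_ballVertices hf)

theorem root_mem_ballFlags {r : ℕ} (hr : 1 ≤ r) : T.root ∈ T.ballFlags r :=
  ballFlags_mono hr (mem_ballFlags_of_vertex (r := 0) rfl)

theorem ballVertices_reroot_subset {k : ℕ} {g : T.Flag} (hg : T.vertex g ∈ T.ballVertices k)
    (r : ℕ) : (T.reroot g).ballVertices r ⊆ T.ballVertices (k + r) := by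
  induction r with
  | zero => rintro _ rfl; exact hg
  | succ r ih =>
    rintro _ ⟨f, hf, rfl⟩
    exact ⟨f, flagsTouching_mono ih hf, rfl⟩

theorem ballFlags_reroot_subset {k : ℕ} {g : T.Flag} (hg : T.vertex g ∈ T.ballVertices k)
    (r : ℕ) : (T.reroot g).ballFlags r ⊆ T.ballFlags (k + r) := by
  cases r with
  | zero => exact fun f hf => hf.elim
  | succ r => exact flagsTouching_mono (ballVertices_reroot_subset hg r)

theorem ballVertices_finite_and_ballFlags_finite (r : ℕ) :
    (T.ballVertices r).Finite ∧ (T.ballFlags r).Finite := by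
  have key : ∀ V : Set T.Vertex, V.Finite → (T.flagsTouching V).Finite := by
    intro V hV
    have h : (T.vertex ⁻¹' V).Finite := by
      rw [← Set.biUnion_preimage_singleton]
      exact hV.biUnion fun v _ => T.locallyFinite v
    refine (h.union ((h.preimage (T.s_injective 0).injOn).union
      (h.preimage ((T.s_injective 0).comp (T.s_injective 1)).injOn))).subset ?_
    rintro f (hf | hf | hf)
    · exact Or.inl hf
    · exact Or.inr (Or.inl hf)
    · exact Or.inr (Or.inr hf)
  induction r with
  | zero => exact ⟨Set.finite_singleton _, Set.finite_empty⟩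
  | succ r ih => exact ⟨(key _ ih.1).image _, key _ ih.1⟩

theorem ballFlags_finite (r : ℕ) : (T.ballFlags r).Finite :=
  (ballVertices_finite_and_ballFlags_finite r).2

theorem exists_mem_ballFlags (f : T.Flag) : ∃ r, f ∈ T.ballFlags r := by
  refine T.connected_induction T.connected (P := fun f => ∃ r, f ∈ T.ballFlags r)
    ⟨1, root_mem_ballFlags le_rfl⟩ ?_ f
  rintro i f ⟨r, hf⟩
  fin_cases i
  · exact ⟨r, s_zero_mem_ballFlags hf⟩
  · exact ⟨r, s_one_mem_ballFlags hf⟩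
  · refine ⟨r + 1, mem_ballFlags_of_vertex ?_⟩
    exact (T.vertex_s_two f).symm ▸ vertex_mem_ballVertices hf

theorem exists_ballFlags_eq_univ [Finite T.Flag] : ∃ r, ∀ f, f ∈ T.ballFlags r := by
  choose R hR using T.exists_mem_ballFlags
  obtain ⟨r, hr⟩ := (Set.finite_range R).bddAbove
  exact ⟨r, fun f => ballFlags_mono (hr ⟨f, rfl⟩) (hR f)⟩

end Balls

/-- A bijection of the flags of two balls respecting all incidences and the root. -/
def IsBallIso {r : ℕ} {T T' : RootedTriangulation κ} (φ : T.ballFlags r ≃ T'.ballFlags r) :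
    Prop :=
  (∀ i, ∀ f g : T.ballFlags r,
    (g : T.Flag) = T.s i f ↔ (φ g : T'.Flag) = T'.s i (φ f)) ∧
  (∀ f g : T.ballFlags r,
    T.vertex f = T.vertex g ↔ T'.vertex (φ f) = T'.vertex (φ g)) ∧
  (∀ f : T.ballFlags r, (f : T.Flag) = T.root ↔ (φ f : T'.Flag) = T'.root)

namespace IsBallIso

variable {r : ℕ} {T T' : RootedTriangulation κ} {φ : T.ballFlags r ≃ T'.ballFlags r}

theorem symm (h : IsBallIso φ) : IsBallIso φ.symm := by
  refine ⟨fun i f g => ?_, fun f g => ?_, fun f => ?_⟩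
  · simpa using (h.1 i (φ.symm f) (φ.symm g)).symm
  · simpa using (h.2.1 (φ.symm f) (φ.symm g)).symm
  · simpa using (h.2.2 (φ.symm f)).symm

theorem apply_s (h : IsBallIso φ) (i : Fin 3) (f : T.ballFlags r)
    (hf : T.s i f ∈ T.ballFlags r) : (φ ⟨T.s i f, hf⟩ : T'.Flag) = T'.s i (φ f) :=
  (h.1 i f ⟨T.s i f, hf⟩).1 rfl

theorem mem_flagsTouching_iff (h : IsBallIso φ) {V : Set T.Vertex} {V' : Set T'.Vertex}
    (hV : ∀ f : T.ballFlags r, T.vertex f ∈ V ↔ T'.vertex (φ f) ∈ V') (f : T.ballFlags r) :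
    (f : T.Flag) ∈ T.flagsTouching V ↔ (φ f : T'.Flag) ∈ T'.flagsTouching V' := by
  have h0 := s_zero_mem_ballFlags f.2
  have h1 := s_one_mem_ballFlags f.2
  have h01 := s_zero_mem_ballFlags h1
  have e01 := h.apply_s 0 ⟨_, h1⟩ h01
  rw [h.apply_s 1 f h1] at e01
  have k0 := hV ⟨_, h0⟩
  have k01 := hV ⟨_, h01⟩
  rw [h.apply_s 0 f h0] at k0
  rw [e01] at k01
  exact or_congr (hV f) (or_congr k0 k01)

/-- If the balls of radius `r` are identified, then so are the smaller balls around other flags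
which they contain. -/
theorem mem_ball_reroot_iff (h : IsBallIso φ) (g : T.ballFlags r) {k : ℕ}
    (hg : T.vertex g ∈ T.ballVertices k) (hg' : T'.vertex (φ g) ∈ T'.ballVertices k) (j : ℕ)
    (hj : k + j ≤ r) :
    (∀ f : T.ballFlags r, T.vertex f ∈ (T.reroot g).ballVertices j ↔
      T'.vertex (φ f) ∈ (T'.reroot (φ g)).ballVertices j) ∧
    (∀ f : T.ballFlags r, (f : T.Flag) ∈ (T.reroot g).ballFlags j ↔
      (φ f : T'.Flag) ∈ (T'.reroot (φ g)).ballFlags j) := by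
  induction j with
  | zero => exact ⟨fun f => h.2.1 f g, fun f => Iff.rfl⟩
  | succ j ih =>
    have key : ∀ f : T.ballFlags r, (f : T.Flag) ∈ (T.reroot g).ballFlags (j + 1) ↔
        (φ f : T'.Flag) ∈ (T'.reroot (φ g)).ballFlags (j + 1) :=
      h.mem_flagsTouching_iff (ih (by omega)).1
    refine ⟨fun f => ⟨?_, ?_⟩, key⟩
    · rintro ⟨f', hf', hv⟩
      have hm : f' ∈ T.ballFlags r := ballFlags_mono hj (ballFlags_reroot_subset hg _ hf')
      exact ⟨(φ ⟨f', hm⟩).1, (key ⟨f', hm⟩).1 hf', (h.2.1 ⟨f', hm⟩ f).1 hv⟩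
    · rintro ⟨f', hf', hv⟩
      have hm : f' ∈ T'.ballFlags r := ballFlags_mono hj (ballFlags_reroot_subset hg' _ hf')
      obtain ⟨f'', hf''⟩ := φ.surjective ⟨f', hm⟩
      obtain rfl : (φ f'' : T'.Flag) = f' := congrArg Subtype.val hf''
      exact ⟨f''.1, (key f'').2 hf', (h.2.1 f'' f).2 hv⟩

/-- The ball of radius `j` around `g` lies in the ball of radius `k + j` around the root, so `φ`
restricts to it. -/
theorem ballEquivalent_reroot (h : IsBallIso φ) (g : T.ballFlags r) {k : ℕ}
    (hg : T.vertex g ∈ T.ballVertices k) (hg' : T'.vertex (φ g) ∈ T'.ballVertices k) (j : ℕ)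
    (hj : k + j ≤ r) : BallEquivalent j (T.reroot g) (T'.reroot (φ g)) := by
  have key := (h.mem_ball_reroot_iff g hg hg' j hj).2
  have hs : ∀ f, f ∈ (T.reroot g).ballFlags j → f ∈ T.ballFlags r :=
    fun f hf => ballFlags_mono hj (ballFlags_reroot_subset hg _ hf)
  have hs' : ∀ f, f ∈ (T'.reroot (φ g)).ballFlags j → f ∈ T'.ballFlags r :=
    fun f hf => ballFlags_mono hj (ballFlags_reroot_subset hg' _ hf)
  let ψ : (T.reroot g).ballFlags j ≃ (T'.reroot (φ g)).ballFlags j :=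
    { toFun := fun f => ⟨(φ ⟨f.1, hs f.1 f.2⟩).1, (key ⟨f.1, hs f.1 f.2⟩).1 f.2⟩
      invFun := fun f => ⟨(φ.symm ⟨f.1, hs' f.1 f.2⟩).1, (key _).2 (by
        rw [Equiv.apply_symm_apply]; exact f.2)⟩
      left_inv := fun f => Subtype.ext (by simp)
      right_inv := fun f => Subtype.ext (by simp) }
  refine ⟨ψ, fun i a b => h.1 i ⟨a.1, hs a.1 a.2⟩ ⟨b.1, hs b.1 b.2⟩,
    fun a b => h.2.1 ⟨a.1, hs a.1 a.2⟩ ⟨b.1, hs b.1 b.2⟩, fun a => ?_⟩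
  show a.1 = g.1 ↔ (φ ⟨a.1, hs a.1 a.2⟩).1 = (φ g).1
  rw [← Subtype.ext_iff, φ.apply_eq_iff_eq, Subtype.ext_iff]
  exact Iff.rfl

theorem apply_root (h : IsBallIso φ) (hr : 1 ≤ r) :
    (φ ⟨T.root, root_mem_ballFlags hr⟩ : T'.Flag) = T'.root :=
  (h.2.2 ⟨T.root, root_mem_ballFlags hr⟩).1 rfl

theorem mem_ballVertices_iff (h : IsBallIso φ) (hr : 1 ≤ r) {j : ℕ} (hj : j ≤ r)
    (f : T.ballFlags r) : T.vertex f ∈ T.ballVertices j ↔ T'.vertex (φ f) ∈ T'.ballVertices j := by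
  have hroot := h.apply_root hr
  have key := (h.mem_ball_reroot_iff ⟨T.root, root_mem_ballFlags hr⟩ (k := 0) rfl
    (congrArg T'.vertex hroot) j (by omega)).1 f
  rw [hroot] at key
  exact key

end IsBallIso

namespace BallEquivalent

variable {r : ℕ} {T T' T'' : RootedTriangulation κ}

theorem refl (r : ℕ) (T : RootedTriangulation κ) : BallEquivalent r T T :=
  ⟨Equiv.refl _, fun _ _ _ => Iff.rfl, fun _ _ => Iff.rfl, fun _ => Iff.rfl⟩

theorem symm (h : BallEquivalent r T T') : BallEquivalent r T' T := by
  obtain ⟨φ, hφ⟩ := h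
  exact ⟨φ.symm, IsBallIso.symm hφ⟩

theorem trans (h : BallEquivalent r T T') (h' : BallEquivalent r T' T'') :
    BallEquivalent r T T'' := by
  obtain ⟨φ, h1, h2, h3⟩ := h
  obtain ⟨ψ, k1, k2, k3⟩ := h'
  exact ⟨φ.trans ψ, fun i f g => (h1 i f g).trans (k1 i _ _),
    fun f g => (h2 f g).trans (k2 _ _), fun f => (h3 f).trans (k3 _)⟩

theorem mono {j : ℕ} (hj : j ≤ r) (h : BallEquivalent r T T') : BallEquivalent j T T' := by
  -- The ball of radius 0 has no flags, so re-centring at the root itself is possible only for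
  -- positive `r`.
  rcases Nat.eq_zero_or_pos r with rfl | hr
  · obtain rfl : j = 0 := by omega
    exact h
  · obtain ⟨φ, hφ⟩ := h
    have hφ : IsBallIso φ := hφ
    have hroot := hφ.apply_root hr
    have key := hφ.ballEquivalent_reroot ⟨T.root, root_mem_ballFlags hr⟩ (k := 0) rfl
      (congrArg T'.vertex hroot) j (by omega)
    rw [hroot] at key
    exact key

end BallEquivalent

section Equivalent

variable {T T' : RootedTriangulation κ}

theorem vertex_apply_eq_iff (φ : T.Flag ≃ T'.Flag) (hφ : ∀ i f, φ (T.s i f) = T'.s i (φ f))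
    (f g : T.Flag) : T.vertex f = T.vertex g ↔ T'.vertex (φ f) = T'.vertex (φ g) := by
  constructor
  · intro h
    exact congrArg (Quot.map φ (rb := fun f g => g = T'.s 1 f ∨ g = T'.s 2 f)
      (by rintro a b (rfl | rfl) <;> simp [hφ])) h
  · intro h
    have hψ : ∀ i f, φ.symm (T'.s i f) = T.s i (φ.symm f) := fun i f => by
      rw [Equiv.symm_apply_eq, hφ, Equiv.apply_symm_apply]
    have := congrArg (Quot.map φ.symm (rb := fun f g => g = T.s 1 f ∨ g = T.s 2 f)
      (by rintro a b (rfl | rfl) <;> simp [hψ])) h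
    change T.vertex (φ.symm (φ f)) = T.vertex (φ.symm (φ g)) at this
    simpa using this

theorem Equivalent.ballEquivalent (h : Equivalent T T') (r : ℕ) : BallEquivalent r T T' := by
  obtain ⟨φ, hφ, hr⟩ := h
  have hv := vertex_apply_eq_iff φ hφ
  have ht : ∀ (V : Set T.Vertex) (V' : Set T'.Vertex),
      (∀ f, T.vertex f ∈ V ↔ T'.vertex (φ f) ∈ V') →
      ∀ f, f ∈ T.flagsTouching V ↔ φ f ∈ T'.flagsTouching V' := by
    intro V V' hV f
    have h0 := hV (T.s 0 f)
    have h01 := hV (T.s 0 (T.s 1 f))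
    rw [hφ] at h0
    rw [hφ, hφ] at h01
    exact or_congr (hV f) (or_congr h0 h01)
  have key : ∀ j, (∀ f, T.vertex f ∈ T.ballVertices j ↔ T'.vertex (φ f) ∈ T'.ballVertices j) ∧
      ∀ f, f ∈ T.ballFlags j ↔ φ f ∈ T'.ballFlags j := by
    intro j
    induction j with
    | zero =>
      refine ⟨fun f => ?_, fun f => Iff.rfl⟩
      have := hv f T.root
      rwa [hr] at this
    | succ j ih =>
      have ih' := ht _ _ ih.1
      refine ⟨fun f => ⟨?_, ?_⟩, ih'⟩
      · rintro ⟨f', hf', h⟩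
        exact ⟨φ f', (ih' f').1 hf', (hv f' f).1 h⟩
      · rintro ⟨f', hf', h⟩
        obtain ⟨f', rfl⟩ := φ.surjective f'
        exact ⟨f', (ih' f').2 hf', (hv f' f).2 h⟩
  refine ⟨φ.subtypeEquiv (key r).2, fun i f g => ?_, fun f g => hv f g, fun f => ?_⟩
  · show (g : T.Flag) = T.s i f ↔ φ g = T'.s i (φ f)
    rw [← hφ, φ.apply_eq_iff_eq]
  · show (f : T.Flag) = T.root ↔ φ f = T'.root
    rw [← hr, φ.apply_eq_iff_eq]

/-- A finite triangulation is determined by a ball which exhausts it. -/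
theorem BallEquivalent.equivalent {r : ℕ} (hT : ∀ f, f ∈ T.ballFlags r)
    (h : BallEquivalent r T T') : Equivalent T T' := by
  obtain ⟨φ, hφ⟩ := h
  have hφ : IsBallIso φ := hφ
  -- No flag of `T` lies outside the ball, so the image of `φ` is closed under all three involutions
  -- and connectedness makes it everything.
  have hT' : ∀ f, f ∈ T'.ballFlags r := by
    refine T'.connected_induction T'.connected (P := fun f => f ∈ T'.ballFlags r)
      (f₀ := φ ⟨T.root, hT _⟩) (Subtype.mem _) ?_
    intro i f hf
    obtain ⟨g, hg⟩ := φ.surjective ⟨f, hf⟩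
    have := hφ.apply_s i g (hT _)
    rw [hg] at this
    exact this ▸ Subtype.mem _
  exact ⟨(Equiv.subtypeUnivEquiv hT).symm.trans (φ.trans (Equiv.subtypeUnivEquiv hT')),
    fun i f => hφ.apply_s i ⟨f, hT f⟩ (hT _), (hφ.2.2 ⟨T.root, hT _⟩).1 rfl⟩

end Equivalent

end RootedTriangulation

/-! ### Cylinder sets and the Borel structure -/

namespace TriangulationSpace

open RootedTriangulation

variable {κ : TriangulationType}

/-- The triangulations whose ball of radius `r` is equivalent to that of `T`. -/
def cylinder (r : ℕ) (T : RootedTriangulation κ) : Set (TriangulationSpace κ) :=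
  {t | ∃ T' : RootedTriangulation κ, t = mk T' ∧ BallEquivalent r T T'}

theorem mk_mem_cylinder {r : ℕ} {T T' : RootedTriangulation κ} :
    mk T' ∈ cylinder r T ↔ BallEquivalent r T T' := by
  constructor
  · rintro ⟨T'', h, h'⟩
    exact h'.trans ((Quotient.exact h.symm : Equivalent T'' T').ballEquivalent r)
  · exact fun h => ⟨T', rfl, h⟩

/-- The cylinder sets. -/
def cylinders (κ : TriangulationType) : Set (Set (TriangulationSpace κ)) :=
  {U | ∃ (r : ℕ) (T : RootedTriangulation κ), U = cylinder r T}

/-- Cylinders behave like balls of an ultrametric: two that meet are nested. -/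
theorem isPiSystem_cylinders : IsPiSystem (cylinders κ) := by
  have key : ∀ (r r' : ℕ) (T T' : RootedTriangulation κ), r ≤ r' →
      (cylinder r T ∩ cylinder r' T').Nonempty →
      cylinder r T ∩ cylinder r' T' = cylinder r' T' := by
    rintro r r' T T' hr ⟨t, h1, h2⟩
    obtain ⟨T'', rfl⟩ : ∃ T'', mk T'' = t := Quotient.exists_rep t
    rw [mk_mem_cylinder] at h1 h2
    rw [Set.inter_eq_right]
    intro t ht
    obtain ⟨S, rfl⟩ : ∃ S, mk S = t := Quotient.exists_rep t
    rw [mk_mem_cylinder] at ht ⊢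
    exact h1.trans ((h2.symm.trans ht).mono hr)
  rintro _ ⟨r, T, rfl⟩ _ ⟨r', T', rfl⟩ hne
  rcases le_total r r' with h | h
  · exact ⟨r', T', key r r' T T' h hne⟩
  · rw [Set.inter_comm] at hne ⊢
    exact ⟨r, T, key r' r T' T h hne⟩

theorem isOpen_cylinder (r : ℕ) (T : RootedTriangulation κ) : IsOpen (cylinder r T) :=
  TopologicalSpace.isOpen_generateFrom_of_mem ⟨r, T, rfl⟩

/-- A function which depends only on the ball of radius `r` is locally constant. -/
theorem isLocallyConstant_of_ballEquivalent {β : Type*} (F : TriangulationSpace κ → β) (r : ℕ)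
    (h : ∀ T T' : RootedTriangulation κ, BallEquivalent r T T' → F (mk T) = F (mk T')) :
    IsLocallyConstant F := by
  rw [IsLocallyConstant.iff_exists_open]
  intro t
  obtain ⟨T, rfl⟩ : ∃ T, mk T = t := Quotient.exists_rep t
  refine ⟨cylinder r T, isOpen_cylinder r T, mk_mem_cylinder.2 (.refl r T), ?_⟩
  rintro _ ⟨T', rfl, hT'⟩
  exact (h T T' hT').symm

theorem isClopen_cylinder (r : ℕ) (T : RootedTriangulation κ) : IsClopen (cylinder r T) := by
  have h : IsLocallyConstant fun t => t ∈ cylinder r T := by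
    refine isLocallyConstant_of_ballEquivalent _ r fun S S' hS => ?_
    rw [mk_mem_cylinder, mk_mem_cylinder]
    exact propext ⟨fun k => k.trans hS, fun k => k.trans hS.symm⟩
  have : cylinder r T = (fun t => t ∈ cylinder r T) ⁻¹' {True} := by ext t; simp
  rw [this]
  exact h.isClopen_fiber True

/-- There are countably many isomorphism types of finite balls. -/
theorem countable_cylinders : (cylinders κ).Countable := by
  -- A code is a radius, a number of flags, and the relations "is the `s i`-image", "same vertex"
  -- and "is the root" carried to `Fin n`; for each `n` there are finitely many such relations.
  let Code : Type := Σ _ : ℕ, Σ n : ℕ,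
    (Fin 3 → Fin n → Fin n → Prop) × (Fin n → Fin n → Prop) × (Fin n → Prop)
  let HasCode (c : Code) (T : RootedTriangulation κ) : Prop :=
    ∃ e : T.ballFlags c.1 ≃ Fin c.2.1,
      (∀ i f g, c.2.2.1 i (e f) (e g) ↔ (g : T.Flag) = T.s i f) ∧
      (∀ f g, c.2.2.2.1 (e f) (e g) ↔ T.vertex f = T.vertex g) ∧
      (∀ f, c.2.2.2.2 (e f) ↔ (f : T.Flag) = T.root)
  have hex : ∀ r T, ∃ c : Code, c.1 = r ∧ HasCode c T := by
    intro r T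
    have := (T.ballFlags_finite r).to_subtype
    obtain ⟨n, ⟨e⟩⟩ := Finite.exists_equiv_fin (T.ballFlags r)
    refine ⟨⟨r, n, fun i a b => (e.symm b : T.Flag) = T.s i (e.symm a),
      fun a b => T.vertex (e.symm a) = T.vertex (e.symm b), fun a => (e.symm a : T.Flag) = T.root⟩,
      rfl, e, ?_⟩
    simp
  have hiso : ∀ c T T', HasCode c T → HasCode c T' → BallEquivalent c.1 T T' := by
    rintro c T T' ⟨e, h1, h2, h3⟩ ⟨e', h1', h2', h3'⟩
    refine ⟨e.trans e'.symm, fun i f g => ?_, fun f g => ?_, fun f => ?_⟩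
    · simp [← h1, ← h1']
    · simp [← h2, ← h2']
    · simp [← h3, ← h3']
  have hc : Countable Code := inferInstance
  refine (Set.countable_range fun c : Code => {t | ∃ T', t = mk T' ∧ HasCode c T'}).mono ?_
  rintro _ ⟨r, T, rfl⟩
  obtain ⟨c, rfl, hT⟩ := hex r T
  refine ⟨c, ?_⟩
  ext t
  constructor
  · rintro ⟨T', rfl, hT'⟩
    exact ⟨T', rfl, hiso c T T' hT hT'⟩
  · rintro ⟨T', rfl, φ, h1, h2, h3⟩
    obtain ⟨e, k1, k2, k3⟩ := hT
    exact ⟨T', rfl, φ.symm.trans e, fun i f g => by simp [k1, h1], fun f g => by simp [k2, h2],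
      fun f => by simp [k3, h3]⟩

theorem borel_eq_generateFrom_cylinders :
    (inferInstance : MeasurableSpace (TriangulationSpace κ))
      = MeasurableSpace.generateFrom (cylinders κ) := by
  have : SecondCountableTopology (TriangulationSpace κ) :=
    ⟨⟨cylinders κ, countable_cylinders, rfl⟩⟩
  exact borel_eq_generateFrom_of_subbasis rfl

theorem measurableSet_cylinder (r : ℕ) (T : RootedTriangulation κ) :
    MeasurableSet (cylinder r T) :=
  (isOpen_cylinder r T).measurableSet

/-- A ball exhausting `T` determines it, so the singleton is itself a cylinder. -/
theorem measurableSet_singleton_mk (T : RootedTriangulation κ) [Finite T.Flag] :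
    MeasurableSet {mk T} := by
  obtain ⟨r, hr⟩ := T.exists_ballFlags_eq_univ
  convert measurableSet_cylinder r T
  ext t
  constructor
  · rintro rfl
    exact mk_mem_cylinder.2 (.refl r T)
  · rintro ⟨T', rfl, hT'⟩
    exact (Quotient.sound (hT'.equivalent hr) : mk T = mk T').symm

end TriangulationSpace

/-! ### Locality of the walk -/

namespace RootedTriangulation

variable {κ : TriangulationType}

/-- Whether the re-rooted triangulation lies in a cylinder set of radius `r` depends only on the
ball of radius `r + 2`. -/
theorem BallEquivalent.walkReroot_map_mem_cylinder {r : ℕ} {T T' : RootedTriangulation κ}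
    (h : BallEquivalent (r + 2) T T') (S : RootedTriangulation κ) :
    T.walkReroot.map (fun t => t ∈ TriangulationSpace.cylinder r S)
      = T'.walkReroot.map (fun t => t ∈ TriangulationSpace.cylinder r S) := by
  classical
  obtain ⟨φ, hφ⟩ := h
  have hφ : IsBallIso φ := hφ
  -- `φ` made total; the value off the ball is arbitrary and never matters.
  let ψ : T.Flag → T'.Flag := fun f => if hf : f ∈ T.ballFlags (r + 2) then φ ⟨f, hf⟩ else T'.root
  have hψ : ∀ f : T.ballFlags (r + 2), ψ f = φ f := fun f => dif_pos f.2
  -- The new root has its vertex in the ball of radius 1, so as a flag it may lie only in the ball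
  -- of radius 2. This is why `r + 1` does not suffice here when `r = 0`.
  have hmem : ∀ f, T.vertex f ∈ T.ballVertices 1 → f ∈ T.ballFlags (r + 2) := fun f hf =>
    ballFlags_mono (by omega) (mem_ballFlags_of_vertex hf)
  have hmem' : ∀ f, T'.vertex f ∈ T'.ballVertices 1 → f ∈ T'.ballFlags (r + 2) := fun f hf =>
    ballFlags_mono (by omega) (mem_ballFlags_of_vertex hf)
  have hball : ∀ f : T.ballFlags (r + 2), T.vertex f ∈ T.ballVertices 1 ↔
      T'.vertex (φ f) ∈ T'.ballVertices 1 :=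
    fun f => hφ.mem_ballVertices_iff (by omega) (by omega) f
  have hbij : ∀ a, T.vertex a ∈ T.ballVertices 1 →
      Set.BijOn ψ (T.rootsAt (T.vertex a)) (T'.rootsAt (T'.vertex (ψ a))) := by
    intro a ha
    have key : ∀ f, f ∈ T.rootsAt (T.vertex a) → f ∈ T.ballFlags (r + 2) := by
      intro f hf
      refine hmem f ?_
      rw [show T.vertex f = T.vertex a from hf]
      exact ha
    rw [hψ ⟨a, hmem a ha⟩]
    refine ⟨fun f hf => ?_, fun f hf g hg hfg => ?_, fun f hf => ?_⟩
    · rw [hψ ⟨f, key f hf⟩]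
      exact (hφ.2.1 ⟨f, key f hf⟩ ⟨a, hmem a ha⟩).1 hf
    · rw [hψ ⟨f, key f hf⟩, hψ ⟨g, key g hg⟩, ← Subtype.ext_iff, φ.apply_eq_iff_eq] at hfg
      exact congrArg Subtype.val hfg
    · have hf' : f ∈ T'.ballFlags (r + 2) := by
        refine hmem' f ?_
        rw [show T'.vertex f = T'.vertex (φ ⟨a, hmem a ha⟩) from hf]
        exact (hball ⟨a, hmem a ha⟩).1 ha
      obtain ⟨g, hg⟩ := φ.surjective ⟨f, hf'⟩
      obtain rfl : (φ g : T'.Flag) = f := congrArg Subtype.val hg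
      exact ⟨g, (hφ.2.1 g ⟨a, hmem a ha⟩).2 hf, hψ g⟩
  have hroot : T.vertex T.root ∈ T.ballVertices 1 :=
    ballVertices_mono (Nat.zero_le 1) rfl
  have hψroot : ψ T.root = T'.root :=
    (hψ ⟨T.root, hmem _ hroot⟩).trans (hφ.apply_root (by omega))
  rw [walkReroot_eq, walkReroot_eq, PMF.map_bind, PMF.map_bind]
  have hb := hbij T.root hroot
  rw [hψroot] at hb
  refine uniformPMF_bind_of_bijOn _ _ _ _ hb fun f hf => ?_
  have hf1 : f ∈ T.ballFlags 1 := Or.inl hf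
  have hf0 : T.vertex (T.s 0 f) ∈ T.ballVertices 1 :=
    vertex_mem_ballVertices (s_zero_mem_ballFlags hf1)
  have hs : ψ (T.s 0 f) = T'.s 0 (ψ f) := by
    rw [hψ ⟨_, hmem _ hf0⟩, hψ ⟨f, hmem _ (vertex_mem_ballVertices hf1)⟩]
    exact hφ.apply_s 0 ⟨f, _⟩ _
  have hb0 := hbij (T.s 0 f) hf0
  rw [hs] at hb0
  rw [PMF.map_comp, PMF.map_comp, ← PMF.bind_pure_comp, ← PMF.bind_pure_comp]
  refine uniformPMF_bind_of_bijOn _ _ _ _ hb0 fun g hg => congrArg PMF.pure (propext ?_)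
  have hg1 : T.vertex g ∈ T.ballVertices 1 := by
    rw [show T.vertex g = T.vertex (T.s 0 f) from hg]
    exact hf0
  have hT := hφ.ballEquivalent_reroot ⟨g, hmem g hg1⟩ hg1 ((hball ⟨g, hmem g hg1⟩).1 hg1) r
    (by omega)
  rw [← hψ] at hT
  show TriangulationSpace.mk (T.reroot g) ∈ _ ↔ TriangulationSpace.mk (T'.reroot (ψ g)) ∈ _
  rw [TriangulationSpace.mk_mem_cylinder, TriangulationSpace.mk_mem_cylinder]
  exact ⟨fun k => k.trans hT, fun k => k.trans hT.symm⟩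

end RootedTriangulation

/-! ### Stationarity of the uniform laws and of their limits -/

namespace TriangulationSpace

open RootedTriangulation

variable {κ : TriangulationType}

/-- Locality of the walk as a Feller property; it yields both the measurability of the kernel and
the test function for the weak limit. -/
theorem isLocallyConstant_walkReroot_cylinder (r : ℕ) (S : RootedTriangulation κ) :
    IsLocallyConstant fun t => (walkReroot t).toMeasure (cylinder r S) := by
  have h : ∀ p : PMF (TriangulationSpace κ), p.toMeasure (cylinder r S)
      = (p.map fun t => t ∈ cylinder r S).toOuterMeasure {True} := by
    intro p
    rw [PMF.toMeasure_apply_eq_toOuterMeasure_apply _ (measurableSet_cylinder r S),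
      PMF.toOuterMeasure_map_apply]
    congr 1
    ext t
    simp
  simp only [h]
  refine isLocallyConstant_of_ballEquivalent _ (r + 2) fun T T' hT => ?_
  exact congrArg (fun p : PMF Prop => p.toOuterMeasure {True}) (hT.walkReroot_map_mem_cylinder S)

theorem measurable_walkReroot :
    Measurable fun t : TriangulationSpace κ => (walkReroot t).toMeasure := by
  refine Measurable.measure_of_isPiSystem_of_isProbabilityMeasure
    borel_eq_generateFrom_cylinders isPiSystem_cylinders ?_
  rintro _ ⟨r, S, rfl⟩
  exact (isLocallyConstant_walkReroot_cylinder r S).continuous.measurable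

theorem rerootedLaw_apply (μ : Measure (TriangulationSpace κ)) {A : Set (TriangulationSpace κ)}
    (hA : MeasurableSet A) :
    rerootedLaw μ A = ∫⁻ t, (walkReroot t).toMeasure A ∂μ :=
  Measure.bind_apply hA measurable_walkReroot.aemeasurable

/-- Rests on the measurability of singletons of finite triangulations; it turns integrals against
the uniform law into finite sums. -/
theorem count_restrict_sphere {N : ℕ} (hS : (sphere κ N).Finite) :
    Measure.count.restrict (sphere κ N) = ∑ t ∈ hS.toFinset, Measure.dirac t := by
  classical
  have hsing : ∀ t ∈ sphere κ N, MeasurableSet {t} := by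
    rintro _ ⟨T, rfl, hT, -⟩
    exact measurableSet_singleton_mk T
  ext A hA
  have hsub : MeasurableSet (↑(hS.toFinset.filter fun t => t ∈ A) : Set (TriangulationSpace κ)) := by
    rw [← Set.biUnion_of_singleton
      ((hS.toFinset.filter fun t => t ∈ A : Finset _) : Set (TriangulationSpace κ))]
    refine Finset.measurableSet_biUnion _ fun t ht => hsing t ?_
    exact hS.mem_toFinset.1 (Finset.mem_filter.1 ht).1
  have hAS : A ∩ sphere κ N = ((hS.toFinset.filter fun t => t ∈ A : Finset _) : Set _) := by
    ext t
    simp [and_comm]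
  rw [Measure.restrict_apply hA, hAS, Measure.count_apply_finset' hsub,
    Measure.finsetSum_apply, Finset.card_filter]
  simp [Measure.dirac_apply' _ hA, Set.indicator_apply]

/-- The uniform distribution on the triangulations of the sphere with `N` vertices is stationary
for the walk.  (By convention `uniformSphere` would be zero if there were infinitely many of them;
the proof covers this case rather than derive finiteness from Euler's formula.) -/
theorem rerootedLaw_uniformSphere (N : ℕ) :
    rerootedLaw (uniformSphere κ N) = uniformSphere κ N := by
  classical
  have hdef : uniformSphere κ N
      = (Measure.count (sphere κ N))⁻¹ • Measure.count.restrict (sphere κ N) := rfl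
  by_cases hS : (sphere κ N).Finite
  · rw [hdef, count_restrict_sphere hS]
    ext A hA
    rw [rerootedLaw_apply _ hA, lintegral_smul_measure, lintegral_finsetSum_measure,
      Measure.smul_apply, Measure.finsetSum_apply]
    congr 1
    have hmeas : Measurable fun t : TriangulationSpace κ => (walkReroot t).toMeasure A :=
      (Measure.measurable_coe hA).comp measurable_walkReroot
    simp only [lintegral_dirac' _ hmeas]
    simp only [PMF.toMeasure_apply _ hA, Measure.dirac_apply' _ hA]
    rw [← Summable.tsum_finsetSum fun _ _ => ENNReal.summable]
    -- With the sums exchanged, the column sums of the kernel appear.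
    have h1 : ∀ u, ∑ t ∈ hS.toFinset, A.indicator (walkReroot t) u
        = A.indicator ((sphere κ N).indicator 1) u := by
      intro u
      by_cases hu : u ∈ A
      · simp only [Set.indicator_of_mem hu, sum_walkReroot_of_sphere hS]
      · simp only [Set.indicator_of_notMem hu, Finset.sum_const_zero]
    simp only [h1]
    rw [tsum_eq_sum (s := hS.toFinset)]
    · refine Finset.sum_congr rfl fun t ht => ?_
      simp [Set.indicator_apply, hS.mem_toFinset.1 ht]
    · intro t ht
      rw [Set.indicator_apply, Set.indicator_of_notMem (by simpa using ht), ite_self]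
  · have h0 : uniformSphere κ N = 0 := by
      rw [hdef, Measure.count_apply_infinite hS]
      simp
    rw [h0]
    exact Measure.bind_zero_left _

/-- Stationarity passes to weak limits. -/
theorem rerootedLaw_eq_of_isSubsequentialLimit {τ : Measure (TriangulationSpace κ)}
    (hτ : IsSubsequentialLimit τ) : rerootedLaw τ = τ := by
  obtain ⟨hprob, n, -, hlim⟩ := hτ
  refine (ext_of_generate_finite _ borel_eq_generateFrom_cylinders isPiSystem_cylinders ?_ ?_).symm
  · rintro _ ⟨r, S, rfl⟩
    have hU := measurableSet_cylinder r S
    have hF := isLocallyConstant_walkReroot_cylinder r S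
    have hle : ∀ t, (walkReroot t).toMeasure (cylinder r S) ≤ 1 := fun t => prob_le_one
    let F : TriangulationSpace κ →ᵇ ℝ := BoundedContinuousFunction.ofNormedAddCommGroup
      (fun t => ((walkReroot t).toMeasure (cylinder r S)).toReal)
      (hF.comp ENNReal.toReal).continuous 1 fun t => by
        rw [Real.norm_of_nonneg ENNReal.toReal_nonneg]
        exact ENNReal.toReal_le_of_le_ofReal zero_le_one (by simpa using hle t)
    let G : TriangulationSpace κ →ᵇ ℝ :=
      BoundedContinuousFunction.indicator (cylinder r S) (isClopen_cylinder r S)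
    have hFint : ∀ μ : Measure (TriangulationSpace κ),
        ∫ t, F t ∂μ = (rerootedLaw μ (cylinder r S)).toReal := by
      intro μ
      rw [rerootedLaw_apply μ hU]
      exact integral_toReal hF.continuous.measurable.aemeasurable
        (ae_of_all _ fun t => (hle t).trans_lt ENNReal.one_lt_top)
    have hGint : ∀ μ : Measure (TriangulationSpace κ),
        ∫ t, G t ∂μ = (μ (cylinder r S)).toReal := fun μ => integral_indicator_one hU
    have h1 := hlim F
    have h2 := hlim G
    -- By stationarity of the uniform laws, the integrals of `F` and `G` along the sequence
    -- coincide.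
    simp only [hFint, rerootedLaw_uniformSphere] at h1
    simp only [hGint] at h2
    have hfin : rerootedLaw τ (cylinder r S) ≠ ⊤ := by
      rw [rerootedLaw_apply τ hU]
      refine ((lintegral_mono hle).trans_lt ?_).ne
      simp
    exact (ENNReal.toReal_eq_toReal_iff' (measure_ne_top _ _) hfin).1
      (tendsto_nhds_unique h2 h1)
  -- Equality of total masses, needed beside the π-system because it need not contain the whole
  -- space.
  · rw [rerootedLaw_apply τ MeasurableSet.univ]
    simp

end TriangulationSpace

theorem mainTheorem6 (κ : TriangulationType) :
    (∀ N : ℕ, 3 ≤ N →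
      TriangulationSpace.rerootedLaw (TriangulationSpace.uniformSphere κ N) =
        TriangulationSpace.uniformSphere κ N) ∧
    (∀ τ : Measure (TriangulationSpace κ), TriangulationSpace.IsSubsequentialLimit τ →
      TriangulationSpace.rerootedLaw τ = τ) :=
  ⟨fun N _ => TriangulationSpace.rerootedLaw_uniformSphere N,
    fun _ hτ => TriangulationSpace.rerootedLaw_eq_of_isSubsequentialLimit hτ⟩
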